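/- Let $m,n,p,q\ge 1$ be integers and $B=\{x\in\mathbb R^m:|x|<1\}$. For $Q\ge1$ let $\mathbb Q_Q(\mathbb R^n)$ be the space of unordered $Q$-tuples $\sum_{i=1}^Q[[a_i]]$ of points of $\mathbb R^n$, with the metric $$\mathcal G\Big(\sum_i[[a_i]],\sum_i[[b_i]]\Big)=\min_\sigma\Big(\sum_i|a_i-b_{\sigma(i)}|^2\Big)^{1/2}$$ ($\sigma$ ranging over the permutations of $\{1,\dots,Q\}$), and let $\eta(\sum_i[[a_i]])=\frac1Q\sum_i a_i$. Definitions. A function $u$ with values in $\mathbb R^n$ is in $W^{1,2}(B,\mathbb R^n)$ if $u\in L^2(B)$ and $u$ has a weak derivative in $L^2(B)$; it is strictly defined if $u(x)=y$ whenever $x\in B$, $y\in\mathbb R^n$ and the mean of $|u-y|$ over the ball of radius $r$ about $x$ tends to $0$ as $r\downarrow0$. Let $\operatorname{ap\,lim}$ denote the approximate limit (the sets $\{y:|\cdot|\ge\varepsilon\}$ have Lebesgue density $0$ at $x$ for all $\varepsilon>0$). The approximate differential $\operatorname{ap}D u(x)$ of a single-valued $u$ is the linear map $L$ with $\operatorname{ap\,lim}_{y\to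 x}|u(y)-u(x)-L(y-x)|/|y-x|=0$. A function $h:B\to\mathbb Q_Q(\mathbb R^n)$ is approximately affinely approximatable at $x$ if there are affine maps $A_1,\dots,A_Q:\mathbb R^m\to\mathbb R^n$ with $h(x)=\sum_i[[A_i(x)]]$ and $\operatorname{ap\,lim}_{y\to x}\mathcal G(h(y),\sum_i[[A_i(y)]])/|y-x|=0$; then $|\operatorname{ap}Dh(x)|^2=\sum_i|L_i|^2$, where $L_i$ is the linear part of $A_i$ and $|L|$ is the Euclidean norm of the matrix of $L$. The Dirichlet integral is $\operatorname{Dir}(h)=\int_B|\operatorname{ap}Dh|^2\,d\mathcal H^m$, where $\mathcal H^m$ is Lebesgue measure; it is said to be well defined and finite if $h$ is approximately affinely approximatable a.e. in $B$ and $|\operatorname{ap}Dh|^2$ is integrable over $B$. Theorem. Let $f_1,\dots,f_p,g_1,\dots,g_q\in W^{1,2}(B,\mathbb R^n)$ be strictly defined, and put $$f=\sum_{i=1}^p[[f_i]],\qquad g=\sum_{j=1}^q[[g_j]],\qquad (f\oplus g)(x)=\sum_{i=1}^p\sum_{j=1}^q[[f_i(x)+g_j(x)]].$$ Then the Dirichlet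 integrals of $f$, $g$ and the $pq$-valued function $f\oplus g$ are well defined and finite, $\eta\circ f$ and $\eta\circ g$ are approximately differentiable a.e. in $B$, the function $\langle\operatorname{ap}D(\eta\circ f),\operatorname{ap}D(\eta\circ g)\rangle$ (Euclidean inner product of matrices) is integrable over $B$, and $$\operatorname{Dir}(f\oplus g)=q\operatorname{Dir}(f)+p\operatorname{Dir}(g)+2pq\int_B\langle\operatorname{ap}D(\eta\circ f),\operatorname{ap}D(\eta\circ g)\rangle\,d\mathcal H^m.$$ -/

import Mathlib

open MeasureTheory Filter Topology

noncomputable section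

namespace MultiValued

/-- Euclidean space `ℝ^k`. -/
abbrev Euc (k : ℕ) : Type := EuclideanSpace ℝ (Fin k)

/-! ### The space of unordered tuples -/

/-- `∑_{i} [[a i]]`, the unordered `Q`-tuple (with multiplicities) with entries `a i`. -/
def diracSum {α : Type*} {Q : ℕ} (a : Fin Q → α) : Sym α Q :=
  Sym.mk (Finset.univ.val.map a) (by simp)

/-- The metric `𝒢` on unordered `Q`-tuples of points of `ℝ^n`: the infimum, over all ways of
matching the entries of `S` with those of `T`, of `(∑ |a_i - b_i|²)^{1/2}`. -/
def metricG {n Q : ℕ} (S T : Sym (Euc n) Q) : ℝ :=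
  sInf {r : ℝ | ∃ a b : Fin Q → Euc n,
    diracSum a = S ∧ diracSum b = T ∧ r = √(∑ i, ‖a i - b i‖ ^ 2)}

/-- The average (centre of mass) `η` of an unordered `Q`-tuple. -/
def average {n Q : ℕ} (S : Sym (Euc n) Q) : Euc n :=
  (Q : ℝ)⁻¹ • (S : Multiset (Euc n)).sum

/-- The sum `∑_{i,j} [[a_i + b_j]]` of `∑_i [[a_i]]` and `∑_j [[b_j]]`. -/
def symAdd {n p q : ℕ} (S : Sym (Euc n) p) (T : Sym (Euc n) q) : Sym (Euc n) (p * q) :=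
  Sym.mk (((S : Multiset (Euc n)) ×ˢ (T : Multiset (Euc n))).map fun c => c.1 + c.2) (by simp)

/-- The tensor sum `f ⊕ g` of a `p`-valued and a `q`-valued function, a `pq`-valued function. -/
def tensorSum {m n p q : ℕ} (f : Euc m → Sym (Euc n) p) (g : Euc m → Sym (Euc n) q) :
    Euc m → Sym (Euc n) (p * q) :=
  fun x => symAdd (f x) (g x)

/-! ### Sobolev functions -/

/-- `G` is a weak derivative of `f` on the open set `U`. -/
def HasWeakDeriv {m n : ℕ} (U : Set (Euc m)) (f : Euc m → Euc n)
    (G : Euc m → Euc m →L[ℝ] Euc n) : Prop :=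
  ∀ φ : Euc m → ℝ, ContDiff ℝ (⊤ : ℕ∞) φ → HasCompactSupport φ → tsupport φ ⊆ U →
    ∀ v : Euc m, ∫ x in U, (fderiv ℝ φ x v) • f x = -∫ x in U, φ x • G x v

/-- The Sobolev space `W^{1,2}(U, ℝ^n)`, as a set of functions (not of classes of functions):
`f` is square integrable on `U` and has a square integrable weak derivative on `U`. -/
def MemW12 {m n : ℕ} (U : Set (Euc m)) (f : Euc m → Euc n) : Prop :=
  MemLp f 2 (volume.restrict U) ∧
    ∃ G : Euc m → Euc m →L[ℝ] Euc n, MemLp G 2 (volume.restrict U) ∧ HasWeakDeriv U f G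

/-- `f` is strictly defined on `U`: at every `x ∈ U` at which `f` has a Lebesgue value `y`, that is
the mean of `|f - y|` over the ball of radius `r` about `x` tends to `0` as `r ↓ 0`, one has
`f x = y`. -/
def StrictlyDefined {m n : ℕ} (U : Set (Euc m)) (f : Euc m → Euc n) : Prop :=
  ∀ x ∈ U, ∀ y : Euc n,
    Tendsto (fun r : ℝ => ⨍ z in Metric.closedBall x r, ‖f z - y‖) (𝓝[>] 0) (𝓝 0) → f x = y

/-! ### Approximate derivatives -/

/-- The approximate limit `ap lim_{y → x} u y = l`: for every `ε > 0` the set of all `y` with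
`|u y - l| ≥ ε` has Lebesgue density zero at `x`. -/
def ApTendsto {m : ℕ} (u : Euc m → ℝ) (x : Euc m) (l : ℝ) : Prop :=
  ∀ ε : ℝ, 0 < ε →
    Tendsto (fun r : ℝ => volume (Metric.closedBall x r ∩ {y | ε ≤ |u y - l|}) /
      volume (Metric.closedBall x r)) (𝓝[>] 0) (𝓝 0)

/-- `L` is an approximate differential at `x` of the single-valued function `h`. -/
def HasApFDerivAt {m n : ℕ} (h : Euc m → Euc n) (L : Euc m →L[ℝ] Euc n) (x : Euc m) : Prop :=
  ApTendsto (fun y => ‖h y - h x - L (y - x)‖ / ‖y - x‖) x 0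

open Classical in
/-- The approximate differential `ap D h (x)` of a single-valued function (`0` if there is
none). -/
def apFDeriv {m n : ℕ} (h : Euc m → Euc n) (x : Euc m) : Euc m →L[ℝ] Euc n :=
  if H : ∃ L, HasApFDerivAt h L x then H.choose else 0

/-- The `Q`-valued function `f` is approximately affinely approximatable at `x` with approximate
differential `D`: there are affine maps `A_1, …, A_Q` with `f x = ∑ [[A_i x]]` and
`ap lim_{y → x} 𝒢(f y, ∑ [[A_i y]]) / |y - x| = 0`, and `D = ∑ [[L_i]]`, where `L_i` is the linear
part of `A_i`. -/
def HasApDerivAt {m n Q : ℕ} (f : Euc m → Sym (Euc n) Q) (D : Sym (Euc m →L[ℝ] Euc n) Q)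
    (x : Euc m) : Prop :=
  ∃ A : Fin Q → (Euc m →ᴬ[ℝ] Euc n),
    f x = diracSum (fun i => A i x) ∧
    ApTendsto (fun y => metricG (f y) (diracSum fun i => A i y) / ‖y - x‖) x 0 ∧
    D = diracSum (fun i => (A i).contLinear)

open Classical in
/-- The approximate differential of a `Q`-valued function (`Q [[0]]` if there is none). -/
def apDeriv {m n Q : ℕ} (f : Euc m → Sym (Euc n) Q) (x : Euc m) : Sym (Euc m →L[ℝ] Euc n) Q :=
  if H : ∃ D, HasApDerivAt f D x then H.choose else diracSum fun _ => 0

/-! ### The Dirichlet integral -/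

/-- The Euclidean inner product of the matrices of two linear maps, `∑_k ⟨L e_k, M e_k⟩`. -/
def matInner {m n : ℕ} (L M : Euc m →L[ℝ] Euc n) : ℝ :=
  ∑ k : Fin m, inner ℝ (L (EuclideanSpace.single k 1)) (M (EuclideanSpace.single k 1))

/-- `|D|² = ∑ |L_i|²` for `D = ∑ [[L_i]]`, where `|L|` is the Euclidean norm of the matrix
of `L`. -/
def normSq {m n Q : ℕ} (D : Sym (Euc m →L[ℝ] Euc n) Q) : ℝ :=
  ((D : Multiset (Euc m →L[ℝ] Euc n)).map fun L => matInner L L).sum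

/-- The Dirichlet integral of `f` over `U` is well defined and finite: `f` is approximately
affinely approximatable almost everywhere in `U` and the squared norm of its approximate
differential is integrable over `U`. -/
def FiniteDir {m n Q : ℕ} (U : Set (Euc m)) (f : Euc m → Sym (Euc n) Q) : Prop :=
  (∀ᵐ x ∂(volume.restrict U), ∃ D, HasApDerivAt f D x) ∧
    IntegrableOn (fun x => normSq (apDeriv f x)) U

/-- The Dirichlet integral of the `Q`-valued function `f` over `U`. -/
def Dir {m n Q : ℕ} (U : Set (Euc m)) (f : Euc m → Sym (Euc n) Q) : ℝ :=
  ∫ x in U, normSq (apDeriv f x)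

end MultiValued

end

open scoped Pointwise

noncomputable section

namespace MultiValued

open scoped Convolution ENNReal

/-! ### The density filter -/

/-! The identity is pointwise. Where every sheet has an approximate differential, say `F i` for the
sheets of `f` and `G j` for those of `g`, the tuple-valued function is approximated by the tuple of
first-order expansions, because `metricG` is at most the cost of the identity matching. So `|ap D
f|²` is `∑ |F i|²`, the sheets of `f ⊕ g` have differentials `F i + G j`, and expanding `∑ |F i + G
j|²` leaves as cross term the inner product of the two sums of differentials, that is `pq` times
that of the averages (`sum_matInner_add_self`). Integrating gives the theorem.

Two points need proof. `apDeriv` is a choice, so its squared norm must not depend on the affine maps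
chosen. For two approximations of the same function, the difference of the two quadratic forms `v ↦
∑ |L_i v|²` is `o(|v|²)` off a set of density zero, and a homogeneous function with this property
vanishes since open cones have positive density (`HasApDerivAt.normSq_unique`).

Also, Sobolev sheets must be approximately differentiable almost everywhere, with the weak
derivative as differential (`HasWeakDeriv.ae_hasApFDerivAt`). For smooth `u`, the mean of `|u y - u
x - L (y - x)| / |y - x|` over a ball about `x` is controlled by the means of `|Du - L|` over
smaller balls. Mollification keeps such control up to the factor `4 ^ m`, Fatou's lemma passes it to
`f`, Lebesgue points of the weak derivative make it small, and Chebyshev's inequality turns it into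
an approximate limit. -/

/-- The sets whose complement has Lebesgue density zero at `x`. -/
def densityFilter {m : ℕ} (x : Euc m) : Filter (Euc m) where
  sets := {s | Tendsto (fun r : ℝ => volume (Metric.closedBall x r ∩ sᶜ) /
    volume (Metric.closedBall x r)) (𝓝[>] 0) (𝓝 0)}
  univ_sets := by simp
  sets_of_superset := by
    intro s t hs hst
    refine tendsto_of_tendsto_of_tendsto_of_le_of_le tendsto_const_nhds hs (fun _ => zero_le)
      fun r => ?_
    dsimp only
    gcongr
  inter_sets := by
    intro s t hs ht
    have h := Tendsto.add hs ht
    rw [add_zero] at h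
    refine tendsto_of_tendsto_of_tendsto_of_le_of_le tendsto_const_nhds h (fun _ => zero_le)
      fun r => ?_
    dsimp only
    rw [← ENNReal.add_div, Set.compl_inter, Set.inter_union_distrib_left]
    gcongr
    exact measure_union_le _ _

theorem mem_densityFilter {m : ℕ} {x : Euc m} {s : Set (Euc m)} :
    s ∈ densityFilter x ↔ Tendsto (fun r : ℝ => volume (Metric.closedBall x r ∩ sᶜ) /
      volume (Metric.closedBall x r)) (𝓝[>] 0) (𝓝 0) :=
  Iff.rfl

/-- Makes approximate limits ordinary filter limits, so that sums, squares and squeezing are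
available. -/
theorem apTendsto_iff {m : ℕ} {u : Euc m → ℝ} {x : Euc m} {l : ℝ} :
    ApTendsto u x l ↔ Tendsto u (densityFilter x) (𝓝 l) := by
  rw [Metric.tendsto_nhds]
  refine forall₂_congr fun ε _ => ?_
  rw [Filter.Eventually, mem_densityFilter]
  simp only [Set.compl_ofPred, not_lt, Real.dist_eq]

theorem densityFilter_le_nhds {m : ℕ} (x : Euc m) : densityFilter x ≤ 𝓝 x := by
  intro s hs
  obtain ⟨ε, hε, hs⟩ := Metric.nhds_basis_closedBall.mem_iff.1 hs
  refine mem_densityFilter.2 (tendsto_const_nhds.congr' ?_)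
  filter_upwards [Ioo_mem_nhdsGT hε] with r hr
  have : Metric.closedBall x r ∩ sᶜ = ∅ := by
    rw [← Set.sdiff_eq, Set.sdiff_eq_empty]
    exact (Metric.closedBall_subset_closedBall hr.2.le).trans hs
  simp [this]

/-- A nonempty open cone with vertex at `x` does not have density zero at `x`. -/
theorem frequently_mem_cone {m : ℕ} (x : Euc m) {C : Set (Euc m)} (hC : IsOpen C)
    (hne : C.Nonempty) (hsmul : ∀ r : ℝ, 0 < r → ∀ v ∈ C, r • v ∈ C) :
    ∃ᶠ y in densityFilter x, y - x ∈ C := by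
  intro h
  have h : Tendsto _ _ _ := mem_densityFilter.1 h
  set c := volume (Metric.closedBall (0 : Euc m) 1 ∩ C) / volume (Metric.closedBall (0 : Euc m) 1)
  have hc : c ≠ 0 := by
    refine ENNReal.div_ne_zero.2 ⟨?_, measure_closedBall_lt_top.ne⟩
    have hpos : 0 < volume (Metric.ball (0 : Euc m) 1 ∩ C) := by
      refine (Metric.isOpen_ball.inter hC).measure_pos _ ?_
      obtain ⟨e, he⟩ := hne
      -- The factor shrinks a vector of the cone into the open unit ball.
      refine ⟨(2 * (‖e‖ + 1))⁻¹ • e, ?_, hsmul _ (by positivity) _ he⟩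
      rw [mem_ball_zero_iff, norm_smul, norm_inv, Real.norm_of_nonneg (by positivity),
        inv_mul_lt_iff₀ (by positivity)]
      linarith [norm_nonneg e]
    exact (hpos.trans_le (measure_mono (Set.inter_subset_inter_left _
      Metric.ball_subset_closedBall))).ne'
  -- Cone and ball scale together, so the density ratio does not depend on the radius.
  have hconst : ∀ᶠ r : ℝ in 𝓝[>] 0, volume (Metric.closedBall x r ∩ {y | ¬y - x ∈ C}ᶜ) /
      volume (Metric.closedBall x r) = c := by
    filter_upwards [self_mem_nhdsWithin] with r hr
    have hr : 0 < r := hr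
    have hset : Metric.closedBall x r ∩ {y | ¬y - x ∈ C}ᶜ =
        (fun y => x + y) '' (r • (Metric.closedBall (0 : Euc m) 1 ∩ C)) := by
      ext y
      simp only [Set.mem_inter_iff, Set.mem_compl_iff, Set.mem_ofPred_eq, not_not,
        Set.image_add_left, Set.mem_preimage, Set.mem_smul_set_iff_inv_smul_mem₀ hr.ne',
        sub_zero, norm_smul, norm_inv, Real.norm_of_nonneg hr.le,
        mem_closedBall_iff_norm, inv_mul_le_iff₀ hr, mul_one, neg_add_eq_sub]
      refine and_congr_right fun _ => ⟨hsmul _ (inv_pos.2 hr) _, fun h => ?_⟩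
      simpa [smul_smul, hr.ne'] using hsmul r hr _ h
    rw [hset, Set.image_add_left, measure_preimage_add, Measure.addHaar_smul,
      Measure.addHaar_closedBall' volume x hr.le, abs_of_pos (by positivity)]
    exact ENNReal.mul_div_mul_left _ _ (by simpa using pow_pos hr _) ENNReal.ofReal_ne_top
  exact hc (tendsto_nhds_unique (h.congr' hconst) tendsto_const_nhds).symm

/-- The quotient `F w / ‖w‖ ^ 2` is constant along rays. If it is nonzero at `v`, it stays away from
zero on an open cone around `v`, and such a cone is not negligible for the density filter. -/
theorem eq_zero_of_homogeneous_of_tendsto {m : ℕ} {x : Euc m} {F : Euc m → ℝ}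
    (hF : Continuous F) (hhom : ∀ (t : ℝ) v, F (t • v) = t ^ 2 * F v)
    (h : Tendsto (fun y => F (y - x) / ‖y - x‖ ^ 2) (densityFilter x) (𝓝 0)) (v : Euc m) :
    F v = 0 := by
  by_contra hv
  have hv0 : v ≠ 0 := by
    rintro rfl
    simpa [hv] using hhom 0 0
  have hvn : 0 < ‖v‖ := norm_pos_iff.2 hv0
  -- Half of the quotient at `v`, so that `v` satisfies the strict inequality defining the cone.
  set c := |F v| / (2 * ‖v‖ ^ 2) with hc
  have hcpos : 0 < c := by positivity
  refine frequently_mem_cone x (C := {w | c * ‖w‖ ^ 2 < |F w|})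
    (isOpen_lt (by fun_prop) (by fun_prop)) ⟨v, ?_⟩ ?_ ?_
  · have : c * ‖v‖ ^ 2 = |F v| / 2 := by rw [hc]; field_simp
    rw [Set.mem_ofPred_eq, this]
    exact half_lt_self (abs_pos.2 hv)
  · intro r hr w hw
    simp only [Set.mem_ofPred_eq, hhom, norm_smul, abs_mul, abs_of_pos (pow_pos hr 2),
      Real.norm_of_nonneg hr.le, mul_pow] at hw ⊢
    nlinarith [pow_pos hr 2]
  · filter_upwards [(Metric.tendsto_nhds.1 h) c hcpos] with y hy
    simp only [not_lt]
    rcases eq_or_ne (y - x) 0 with h0 | h0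
    · have : F 0 = 0 := by simpa using hhom 0 0
      simp [h0, this]
    · have hpos : 0 < ‖y - x‖ ^ 2 := by positivity
      rw [Real.dist_eq, sub_zero, abs_div, abs_of_pos hpos, div_lt_iff₀ hpos] at hy
      exact hy.le

/-! ### Single-valued approximate differentials -/

theorem hasApFDerivAt_iff {m n : ℕ} {h : Euc m → Euc n} {L : Euc m →L[ℝ] Euc n} {x : Euc m} :
    HasApFDerivAt h L x ↔
      Tendsto (fun y => ‖h y - h x - L (y - x)‖ / ‖y - x‖) (densityFilter x) (𝓝 0) :=
  apTendsto_iff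

theorem HasApFDerivAt.unique {m n : ℕ} {h : Euc m → Euc n} {L M : Euc m →L[ℝ] Euc n}
    {x : Euc m} (hL : HasApFDerivAt h L x) (hM : HasApFDerivAt h M x) : L = M := by
  rw [hasApFDerivAt_iff] at hL hM
  have h0 : Tendsto (fun y => ‖(L - M) (y - x)‖ ^ 2 / ‖y - x‖ ^ 2) (densityFilter x) (𝓝 0) := by
    have h2 := (hL.add hM).pow 2
    simp only [add_zero, ne_eq, OfNat.ofNat_ne_zero, not_false_eq_true, zero_pow] at h2
    refine squeeze_zero (fun _ => by positivity) (fun y => ?_) h2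
    rw [← div_pow, ← add_div]
    gcongr
    calc ‖(L - M) (y - x)‖ = ‖(h y - h x - M (y - x)) - (h y - h x - L (y - x))‖ := by
          congr 1; simp
      _ ≤ _ := by rw [add_comm]; exact norm_sub_le _ _
  ext1 v
  have := eq_zero_of_homogeneous_of_tendsto (F := fun v => ‖(L - M) v‖ ^ 2) (by fun_prop)
    (fun t v => by simp only [map_smul, norm_smul, mul_pow, Real.norm_eq_abs, sq_abs]) h0 v
  simpa [sub_eq_zero] using this

theorem HasApFDerivAt.apFDeriv_eq {m n : ℕ} {h : Euc m → Euc n} {L : Euc m →L[ℝ] Euc n}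
    {x : Euc m} (hL : HasApFDerivAt h L x) : apFDeriv h x = L := by
  have H : ∃ L, HasApFDerivAt h L x := ⟨L, hL⟩
  rw [apFDeriv, dif_pos H]
  exact H.choose_spec.unique hL

theorem HasApFDerivAt.add {m n : ℕ} {h k : Euc m → Euc n} {L M : Euc m →L[ℝ] Euc n}
    {x : Euc m} (hL : HasApFDerivAt h L x) (hM : HasApFDerivAt k M x) :
    HasApFDerivAt (fun y => h y + k y) (L + M) x := by
  rw [hasApFDerivAt_iff] at *
  have h2 := hL.add hM
  rw [add_zero] at h2
  refine squeeze_zero (fun _ => by positivity) (fun y => ?_) h2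
  rw [← add_div]
  gcongr
  refine le_trans (le_of_eq ?_) (norm_add_le _ _)
  congr 1
  rw [add_apply]
  abel

theorem HasApFDerivAt.const_smul {m n : ℕ} {h : Euc m → Euc n} {L : Euc m →L[ℝ] Euc n}
    {x : Euc m} (hL : HasApFDerivAt h L x) (c : ℝ) :
    HasApFDerivAt (fun y => c • h y) (c • L) x := by
  rw [hasApFDerivAt_iff] at *
  have h2 := hL.const_mul ‖c‖
  rw [mul_zero] at h2
  refine h2.congr fun y => ?_
  rw [← mul_div_assoc, ← norm_smul, smul_sub, smul_sub]
  rfl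

theorem HasApFDerivAt.sum {m n : ℕ} {ι : Type*} {s : Finset ι} {h : ι → Euc m → Euc n}
    {L : ι → Euc m →L[ℝ] Euc n} {x : Euc m} (hL : ∀ i ∈ s, HasApFDerivAt (h i) (L i) x) :
    HasApFDerivAt (fun y => ∑ i ∈ s, h i y) (∑ i ∈ s, L i) x := by
  classical
  induction s using Finset.induction_on with
  | empty => simpa [hasApFDerivAt_iff] using tendsto_const_nhds
  | insert i s hi ih =>
    simp only [Finset.sum_insert hi]
    exact (hL i (Finset.mem_insert_self _ _)).add
      (ih fun j hj => hL j (Finset.mem_insert_of_mem hj))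

/-! ### Unordered tuples -/

/-- Equal multisets give fibres of equal cardinality over each point; bijections between the fibres
glue to a permutation. -/
theorem diracSum_eq_iff {α : Type*} {Q : ℕ} {a b : Fin Q → α} :
    diracSum a = diracSum b ↔ ∃ σ : Equiv.Perm (Fin Q), a = b ∘ σ := by
  rw [diracSum, diracSum, ← Sym.coe_inj]
  change Multiset.map a Finset.univ.val = Multiset.map b Finset.univ.val ↔ _
  classical
  constructor
  · intro h
    have hcard : ∀ y : α, Fintype.card {i // a i = y} = Fintype.card {i // b i = y} := by
      intro y
      have := congrArg (Multiset.count y) h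
      simp only [Multiset.count_map] at this
      simp only [Fintype.card_subtype, Finset.card_def, Finset.filter_val, eq_comm (b := y)]
      exact this
    refine ⟨Equiv.ofFiberEquiv fun y => Fintype.equivOfCardEq (hcard y), ?_⟩
    funext i
    exact (Equiv.ofFiberEquiv_map _ i).symm
  · rintro ⟨σ, rfl⟩
    rw [← Multiset.map_map, Multiset.map_univ_val_equiv]

theorem exists_eq_diracSum {α : Type*} {Q : ℕ} (S : Sym α Q) : ∃ a, S = diracSum a := by
  obtain ⟨v, rfl⟩ : ∃ v : List.Vector α Q, Sym.ofVector v = S := by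
    obtain ⟨s, hs⟩ := S
    induction s using Quotient.inductionOn with
    | _ l => exact ⟨⟨l, hs⟩, rfl⟩
  refine ⟨v.get, ?_⟩
  rw [← Sym.coe_inj]
  change (v.toList : Multiset α) = Multiset.map v.get Finset.univ.val
  rw [Fin.univ_val_map, ← List.Vector.toList_ofFn, List.Vector.ofFn_get]

theorem metricG_nonneg {n Q : ℕ} (S T : Sym (Euc n) Q) : 0 ≤ metricG S T := by
  refine Real.sInf_nonneg ?_
  rintro _ ⟨a, b, -, -, rfl⟩
  positivity

theorem metricG_diracSum_le {n Q : ℕ} (a b : Fin Q → Euc n) :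
    metricG (diracSum a) (diracSum b) ≤ √(∑ i, ‖a i - b i‖ ^ 2) := by
  refine csInf_le ⟨0, ?_⟩ ⟨a, b, rfl, rfl, rfl⟩
  rintro _ ⟨a, b, -, -, rfl⟩
  positivity

/-- A near-optimal pair of enumerations differs from `a` and `b` by permutations, and each single
distance is at most the root of the sum of squares. -/
theorem exists_perm_of_metricG_lt {n Q : ℕ} {a b : Fin Q → Euc n} {r : ℝ}
    (h : metricG (diracSum a) (diracSum b) < r) :
    ∃ σ : Equiv.Perm (Fin Q), ∀ i, ‖a i - b (σ i)‖ < r := by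
  obtain ⟨_, ⟨a', b', ha, hb, rfl⟩, hr⟩ :=
    exists_lt_of_csInf_lt (s := {r : ℝ | ∃ a' b' : Fin Q → Euc n,
      diracSum a' = diracSum a ∧ diracSum b' = diracSum b ∧ r = √(∑ i, ‖a' i - b' i‖ ^ 2)})
      ⟨_, a, b, rfl, rfl, rfl⟩ h
  obtain ⟨σ, rfl⟩ := diracSum_eq_iff.1 ha
  obtain ⟨τ, rfl⟩ := diracSum_eq_iff.1 hb
  refine ⟨σ.symm.trans τ, fun i => lt_of_le_of_lt ?_ hr⟩
  refine Real.le_sqrt_of_sq_le ?_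
  have := Finset.single_le_sum (f := fun i => ‖(a ∘ σ) i - (b ∘ τ) i‖ ^ 2)
    (fun i _ => by positivity) (Finset.mem_univ (σ.symm i))
  simpa using this

theorem average_diracSum {n Q : ℕ} (a : Fin Q → Euc n) :
    average (diracSum a) = (Q : ℝ)⁻¹ • ∑ i, a i := rfl

theorem normSq_diracSum {m n Q : ℕ} (L : Fin Q → Euc m →L[ℝ] Euc n) :
    normSq (diracSum L) = ∑ i, matInner (L i) (L i) := by
  change (Multiset.map _ (Multiset.map L Finset.univ.val)).sum = _
  rw [Multiset.map_map]
  rfl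

theorem symAdd_diracSum {n p q : ℕ} (a : Fin p → Euc n) (b : Fin q → Euc n) :
    symAdd (diracSum a) (diracSum b) =
      diracSum fun k : Fin (p * q) => a (finProdFinEquiv.symm k).1 + b (finProdFinEquiv.symm k).2 := by
  rw [← Sym.coe_inj]
  change Multiset.map _ (Multiset.map a Finset.univ.val ×ˢ Multiset.map b Finset.univ.val) =
    Multiset.map _ (Finset.univ : Finset (Fin (p * q))).val
  have h : (Finset.univ : Finset (Fin (p * q))).val =
      Multiset.map finProdFinEquiv (Finset.univ : Finset (Fin p × Fin q)).val := by
    rw [Multiset.map_univ_val_equiv]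
  rw [h, Multiset.map_map, ← Finset.univ_product_univ, Finset.product_val]
  simp only [SProd.sprod, Multiset.product, Multiset.bind_map, Multiset.map_bind, Multiset.map_map,
    Function.comp_def, Equiv.symm_apply_apply]

/-! ### Approximate differentials of multiple-valued functions -/

/-- Matching both `A` and `B` with `f y` matches them with each other up to `2 * δ * ‖y - x‖`. Close
to `x` only sheets with the same value at `x` can be matched, so the error bounds the difference of
linear parts at `y - x`. The matching may depend on `y`, but sums of squares over all sheets do not
see it. -/
theorem tendsto_sum_sq_sub {m n Q : ℕ} {f : Euc m → Sym (Euc n) Q} {x : Euc m}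
    {A B : Fin Q → (Euc m →ᴬ[ℝ] Euc n)}
    (hA : Tendsto (fun y => metricG (f y) (diracSum fun i => A i y) / ‖y - x‖)
      (densityFilter x) (𝓝 0))
    (hB : Tendsto (fun y => metricG (f y) (diracSum fun i => B i y) / ‖y - x‖)
      (densityFilter x) (𝓝 0)) :
    Tendsto (fun y => (∑ i, ‖(A i).contLinear (y - x)‖ ^ 2 -
      ∑ i, ‖(B i).contLinear (y - x)‖ ^ 2) / ‖y - x‖ ^ 2) (densityFilter x) (𝓝 0) := by
  set K : ℝ := ∑ i, ‖(A i).contLinear‖ + ∑ i, ‖(B i).contLinear‖ with hK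
  have hK0 : 0 ≤ K := by positivity
  rw [Metric.tendsto_nhds]
  intro ε hε
  -- `2 * δ * K` is the final bound for the quotient: `2 * δ` from the matching, `K` from factoring
  -- a difference of squares.
  obtain ⟨δ, hδ, hδε⟩ : ∃ δ : ℝ, 0 < δ ∧ 2 * δ * K < ε := by
    refine ⟨ε / (2 * (K + 1)), by positivity, ?_⟩
    rw [mul_div_assoc', div_mul_eq_mul_div, div_lt_iff₀ (by positivity)]
    nlinarith
  have hsep : ∀ᶠ y in densityFilter x, ∀ i j, A i x ≠ B j x →
      2 * δ * ‖y - x‖ < ‖A i y - B j y‖ := by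
    refine densityFilter_le_nhds x ?_
    refine eventually_all.2 fun i => eventually_all.2 fun j => ?_
    by_cases hij : A i x = B j x
    · exact Eventually.of_forall fun y hy => absurd hij hy
    have h1 : Continuous fun y => 2 * δ * ‖y - x‖ := by fun_prop
    have h2 : Continuous fun y => ‖A i y - B j y‖ :=
      ((A i).continuous.sub (B j).continuous).norm
    have := h1.continuousAt.eventually_lt (x₀ := x) h2.continuousAt
      (by simpa [sub_eq_zero] using hij)
    filter_upwards [this] with y hy _ using hy
  filter_upwards [(Metric.tendsto_nhds.1 hA) δ hδ, (Metric.tendsto_nhds.1 hB) δ hδ, hsep]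
    with y hAy hBy hy
  rcases eq_or_ne y x with rfl | hyx
  · simpa using hε
  have hpos : 0 < ‖y - x‖ := norm_pos_iff.2 (sub_ne_zero.2 hyx)
  rw [Real.dist_eq, sub_zero, abs_of_nonneg (div_nonneg (metricG_nonneg _ _) hpos.le),
    div_lt_iff₀ hpos] at hAy hBy
  obtain ⟨c, hc⟩ := exists_eq_diracSum (f y)
  rw [hc] at hAy hBy
  obtain ⟨σ, hσ⟩ := exists_perm_of_metricG_lt hAy
  obtain ⟨τ, hτ⟩ := exists_perm_of_metricG_lt hBy
  have hclose : ∀ i, ‖A (σ i) y - B (τ i) y‖ < 2 * δ * ‖y - x‖ := by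
    intro i
    calc ‖A (σ i) y - B (τ i) y‖ = ‖(c i - B (τ i) y) - (c i - A (σ i) y)‖ := by congr 1; abel
      _ ≤ ‖c i - B (τ i) y‖ + ‖c i - A (σ i) y‖ := norm_sub_le _ _
      _ < _ := by linarith [hσ i, hτ i]
  have hval : ∀ (T : Euc m →ᴬ[ℝ] Euc n), T y = T.contLinear (y - x) + T x := fun T => by
    have := T.map_vadd x (y - x)
    simpa using this
  have hlin : ∀ i, ‖(A (σ i)).contLinear (y - x) - (B (τ i)).contLinear (y - x)‖ <
      2 * δ * ‖y - x‖ := by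
    intro i
    have hx : A (σ i) x = B (τ i) x := by
      by_contra hne
      exact absurd (hclose i) (hy _ _ hne).not_gt
    have := hclose i
    rwa [hval (A (σ i)), hval (B (τ i)), hx, add_sub_add_right_eq_sub] at this
  rw [Real.dist_eq, sub_zero, abs_div, abs_of_pos (pow_pos hpos 2), div_lt_iff₀ (pow_pos hpos 2)]
  -- Reindexing by the two matchings allows a term-by-term comparison.
  rw [← Equiv.sum_comp σ (fun i => ‖(A i).contLinear (y - x)‖ ^ 2),
    ← Equiv.sum_comp τ (fun i => ‖(B i).contLinear (y - x)‖ ^ 2), ← Finset.sum_sub_distrib]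
  refine lt_of_le_of_lt (b := (2 * δ * K) * ‖y - x‖ ^ 2) ?_ (by gcongr)
  rw [hK, ← Equiv.sum_comp σ (fun i => ‖(A i).contLinear‖),
    ← Equiv.sum_comp τ (fun i => ‖(B i).contLinear‖), ← Finset.sum_add_distrib, Finset.mul_sum,
    Finset.sum_mul]
  refine (Finset.abs_sum_le_sum_abs _ _).trans (Finset.sum_le_sum fun i _ => ?_)
  rw [sq_sub_sq, abs_mul, abs_of_nonneg (by positivity)]
  calc _ ≤ (‖(A (σ i)).contLinear‖ * ‖y - x‖ + ‖(B (τ i)).contLinear‖ * ‖y - x‖) *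
        (2 * δ * ‖y - x‖) := by
        gcongr
        · exact ContinuousLinearMap.le_opNorm _ _
        · exact ContinuousLinearMap.le_opNorm _ _
        · exact (abs_norm_sub_norm_le _ _).trans (hlin i).le
    _ = _ := by ring

/-- The quadratic forms of the two approximations agree; evaluating them at the basis vectors and
summing gives the matrix norms. -/
theorem HasApDerivAt.normSq_unique {m n Q : ℕ} {f : Euc m → Sym (Euc n) Q}
    {D E : Sym (Euc m →L[ℝ] Euc n) Q} {x : Euc m} (hD : HasApDerivAt f D x)
    (hE : HasApDerivAt f E x) : normSq D = normSq E := by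
  obtain ⟨A, -, hA, rfl⟩ := hD
  obtain ⟨B, -, hB, rfl⟩ := hE
  have h := eq_zero_of_homogeneous_of_tendsto
    (F := fun v => ∑ i, ‖(A i).contLinear v‖ ^ 2 - ∑ i, ‖(B i).contLinear v‖ ^ 2)
    (by fun_prop)
    (fun t v => by
      simp only [map_smul, norm_smul, mul_pow, Real.norm_eq_abs, sq_abs, mul_sub, Finset.mul_sum])
    (tendsto_sum_sq_sub (apTendsto_iff.1 hA) (apTendsto_iff.1 hB))
  simp only [normSq_diracSum, matInner, real_inner_self_eq_norm_sq]
  rw [Finset.sum_comm, Finset.sum_comm (s := Finset.univ (α := Fin Q))]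
  exact Finset.sum_congr rfl fun k _ => sub_eq_zero.1 (h _)

theorem HasApDerivAt.normSq_apDeriv {m n Q : ℕ} {f : Euc m → Sym (Euc n) Q}
    {D : Sym (Euc m →L[ℝ] Euc n) Q} {x : Euc m} (hD : HasApDerivAt f D x) :
    normSq (apDeriv f x) = normSq D := by
  have H : ∃ D, HasApDerivAt f D x := ⟨D, hD⟩
  rw [apDeriv, dif_pos H]
  exact H.choose_spec.normSq_unique hD

theorem hasApDerivAt_diracSum {m n Q : ℕ} {u : Fin Q → Euc m → Euc n}
    {L : Fin Q → Euc m →L[ℝ] Euc n} {x : Euc m} (h : ∀ i, HasApFDerivAt (u i) (L i) x) :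
    HasApDerivAt (fun y => diracSum fun i => u i y) (diracSum L) x := by
  have happ : ∀ i y, ((L i).toContinuousAffineMap +
      ContinuousAffineMap.const ℝ (Euc m) (u i x - L i x)) y = u i x + L i (y - x) := by
    intro i y
    simp only [ContinuousAffineMap.add_apply, ContinuousLinearMap.coe_toContinuousAffineMap,
      ContinuousAffineMap.coe_const, Function.const_apply, map_sub]
    abel
  refine ⟨fun i => (L i).toContinuousAffineMap +
    ContinuousAffineMap.const ℝ (Euc m) (u i x - L i x), ?_, ?_, ?_⟩
  · simp [happ]
  · simp only [happ]
    rw [apTendsto_iff]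
    have h2 := tendsto_finsetSum Finset.univ fun i _ => (hasApFDerivAt_iff.1 (h i)).pow 2
    have h3 := h2.sqrt
    simp only [ne_eq, OfNat.ofNat_ne_zero, not_false_eq_true, zero_pow, Finset.sum_const_zero,
      Real.sqrt_zero] at h3
    refine squeeze_zero (fun y => div_nonneg (metricG_nonneg _ _) (norm_nonneg _)) (fun y => ?_) h3
    simp only [div_pow, ← Finset.sum_div]
    rw [Real.sqrt_div' _ (by positivity), Real.sqrt_sq (norm_nonneg _)]
    gcongr
    refine (metricG_diracSum_le _ _).trans (le_of_eq ?_)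
    simp only [sub_sub]
  · congr 1
    ext i v
    simp

/-! ### Mollification -/

theorem volume_closedBall_mul {m : ℕ} (x y : Euc m) {t r : ℝ} (ht : 0 ≤ t) (hr : 0 ≤ r) :
    volume (Metric.closedBall x (t * r)) =
      ENNReal.ofReal (t ^ m) * volume (Metric.closedBall y r) := by
  rw [Measure.addHaar_closedBall' volume x (by positivity), Measure.addHaar_closedBall' volume y hr,
    ← mul_assoc, ← ENNReal.ofReal_mul (by positivity), finrank_euclideanSpace_fin, mul_pow]

theorem volume_closedBall_two_mul {m : ℕ} (x : Euc m) {r : ℝ} (hr : 0 ≤ r) :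
    volume (Metric.closedBall x (2 * r)) = 2 ^ m * volume (Metric.closedBall x r) := by
  rw [volume_closedBall_mul x x zero_le_two hr, ENNReal.ofReal_pow zero_le_two, ENNReal.ofReal_ofNat]

theorem lintegral_normed {m : ℕ} (φ : ContDiffBump (0 : Euc m)) :
    ∫⁻ z, ENNReal.ofReal (φ.normed volume z) = 1 := by
  rw [← ofReal_integral_eq_lintegral_ofReal φ.integrable_normed
    (Eventually.of_forall φ.nonneg_normed), φ.integral_normed, ENNReal.ofReal_one]

/-- Since the bump is constant on the ball of radius `rIn ≥ rOut / 2`, normalisation bounds its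
height by `2 ^ m` over the volume of the outer ball. -/
theorem normed_mul_volume_le {m : ℕ} (φ : ContDiffBump (0 : Euc m)) (hφ : φ.rOut ≤ 2 * φ.rIn)
    (x z : Euc m) :
    ENNReal.ofReal (φ.normed volume z) * volume (Metric.closedBall x φ.rOut) ≤ 2 ^ m := by
  have h := φ.normed_le_div_measure_closedBall_rOut volume 2 hφ z
  have hpos : 0 < volume.real (Metric.closedBall (0 : Euc m) φ.rOut) :=
    ENNReal.toReal_pos (Metric.measure_closedBall_pos _ _ φ.rOut_pos).ne'
      measure_closedBall_lt_top.ne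
  rw [le_div_iff₀ hpos, finrank_euclideanSpace_fin] at h
  have hx : volume (Metric.closedBall x φ.rOut) =
      ENNReal.ofReal (volume.real (Metric.closedBall (0 : Euc m) φ.rOut)) := by
    rw [ofReal_measureReal measure_closedBall_lt_top.ne]
    simpa using volume_closedBall_mul x 0 zero_le_one φ.rOut_pos.le
  rw [hx, ← ENNReal.ofReal_mul (φ.nonneg_normed z)]
  refine (ENNReal.ofReal_le_ofReal h).trans_eq ?_
  rw [ENNReal.ofReal_pow zero_le_two, ENNReal.ofReal_ofNat]

/-- If `rOut ≤ s`, the total mass one suffices, as the larger ball lies in the ball of radius `2 *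
s`. Otherwise the height bound gives one factor `2 ^ m` and doubling the ball of radius `rOut` the
other. -/
theorem setLIntegral_normed_sub_mul_volume_le {m : ℕ} (φ : ContDiffBump (0 : Euc m))
    (hφ : φ.rOut ≤ 2 * φ.rIn) (x w : Euc m) {s : ℝ} (hs : 0 < s) :
    (∫⁻ z in Metric.closedBall x s, ENNReal.ofReal (φ.normed volume (z - w))) *
      volume (Metric.closedBall x (s + φ.rOut)) ≤ 4 ^ m * volume (Metric.closedBall x s) := by
  have h4 : (4 : ℝ≥0∞) ^ m = 2 ^ m * 2 ^ m := by rw [← mul_pow]; norm_num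
  have h1 : (1 : ℝ≥0∞) ≤ 2 ^ m := one_le_pow₀ one_le_two
  rcases le_total φ.rOut s with hle | hle
  · calc _ ≤ 1 * volume (Metric.closedBall x (2 * s)) := by
          gcongr
          · refine (setLIntegral_le_lintegral _ _).trans ?_
            rw [lintegral_sub_right_eq_self (fun z => ENNReal.ofReal (φ.normed volume z)) w,
              lintegral_normed]
          · linarith
      _ = 1 * (2 ^ m * volume (Metric.closedBall x s)) := by
          rw [one_mul, one_mul, volume_closedBall_two_mul x hs.le]
      _ ≤ 2 ^ m * (2 ^ m * volume (Metric.closedBall x s)) := by gcongr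
      _ = _ := by rw [h4, mul_assoc]
  · calc _ ≤ (∫⁻ z in Metric.closedBall x s, ENNReal.ofReal (φ.normed volume (z - w))) *
          (2 ^ m * volume (Metric.closedBall x φ.rOut)) := by
          rw [← volume_closedBall_two_mul x φ.rOut_pos.le]
          gcongr
          linarith
      _ = 2 ^ m * ∫⁻ z in Metric.closedBall x s, ENNReal.ofReal (φ.normed volume (z - w)) *
          volume (Metric.closedBall x φ.rOut) := by
          rw [lintegral_mul_const' _ _ measure_closedBall_lt_top.ne]
          ring
      _ ≤ 2 ^ m * ∫⁻ z in Metric.closedBall x s, 2 ^ m := by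
          gcongr
          exact normed_mul_volume_le φ hφ _ _
      _ = _ := by rw [setLIntegral_const, h4, mul_assoc]

/-- If the means of `h` over the balls about `x` of radius at most `R` are bounded by `η`, then so
are, up to a constant, the means of the mollifications of `h`. -/
theorem setLIntegral_mollify_le {m : ℕ} {φ : ContDiffBump (0 : Euc m)} (hφ : φ.rOut ≤ 2 * φ.rIn)
    {h : Euc m → ℝ≥0∞} (hh : AEMeasurable h) {x : Euc m} {η : ℝ≥0∞} {R : ℝ}
    (hη : ∀ s, 0 < s → s ≤ R →
      ∫⁻ w in Metric.closedBall x s, h w ≤ η * volume (Metric.closedBall x s))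
    {s : ℝ} (hs : 0 < s) (hsR : s + φ.rOut ≤ R) :
    ∫⁻ z in Metric.closedBall x s, ∫⁻ w, ENNReal.ofReal (φ.normed volume (z - w)) * h w ≤
      4 ^ m * η * volume (Metric.closedBall x s) := by
  have hε := φ.rOut_pos
  have hφc : Continuous (φ.normed volume) := (φ.contDiff_normed (n := 0)).continuous
  have hφm : ∀ w, Measurable fun z => ENNReal.ofReal (φ.normed volume (z - w)) := fun w =>
    (ENNReal.continuous_ofReal.comp (hφc.comp (continuous_id.sub continuous_const))).measurable
  set V := volume (Metric.closedBall x (s + φ.rOut))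
  have hV0 : V ≠ 0 := (Metric.measure_closedBall_pos _ _ (by positivity)).ne'
  have hV1 : V ≠ ∞ := measure_closedBall_lt_top.ne
  rw [lintegral_lintegral_swap]
  swap
  · refine AEMeasurable.mul ?_ hh.comp_snd
    exact (ENNReal.continuous_ofReal.comp (hφc.comp
      (continuous_fst.sub continuous_snd))).aemeasurable
  calc ∫⁻ w, ∫⁻ z in Metric.closedBall x s, ENNReal.ofReal (φ.normed volume (z - w)) * h w
      ≤ ∫⁻ w, (Metric.closedBall x (s + φ.rOut)).indicator
          (fun w => 4 ^ m * volume (Metric.closedBall x s) / V * h w) w := by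
        refine lintegral_mono fun w => ?_
        dsimp only
        rw [lintegral_mul_const _ (hφm w)]
        by_cases hw : w ∈ Metric.closedBall x (s + φ.rOut)
        · rw [Set.indicator_of_mem hw]
          gcongr
          rw [ENNReal.le_div_iff_mul_le (Or.inl hV0) (Or.inl hV1)]
          exact setLIntegral_normed_sub_mul_volume_le φ hφ x w hs
        -- For `w` this far out, the bump centred at `w` misses the ball of radius `s`.
        · have : ∫⁻ z in Metric.closedBall x s, ENNReal.ofReal (φ.normed volume (z - w)) = 0 := by
            rw [setLIntegral_congr_fun (g := fun _ => 0) Metric.isClosed_closedBall.measurableSet,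
              lintegral_zero]
            intro z hz
            have hzw : z - w ∉ Function.support (φ.normed volume) := by
              rw [φ.support_normed_eq, mem_ball_zero_iff, not_lt, ← dist_eq_norm]
              rw [Metric.mem_closedBall, not_le] at hw
              rw [Metric.mem_closedBall] at hz
              linarith [dist_triangle w z x, dist_comm w z]
            simp [Function.notMem_support.1 hzw]
          rw [this, zero_mul]
          exact zero_le
    _ = 4 ^ m * volume (Metric.closedBall x s) / V *
          ∫⁻ w in Metric.closedBall x (s + φ.rOut), h w := by
        rw [lintegral_indicator Metric.isClosed_closedBall.measurableSet, lintegral_const_mul']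
        exact ENNReal.div_ne_top (ENNReal.mul_ne_top (by simp) measure_closedBall_lt_top.ne) hV0
    _ ≤ 4 ^ m * volume (Metric.closedBall x s) / V * (η * V) := by
        gcongr
        exact hη _ (by positivity) hsR
    _ = 4 ^ m * η * (volume (Metric.closedBall x s) * (V / V)) := by
        simp only [div_eq_mul_inv]; ring
    _ = _ := by rw [ENNReal.div_self hV0 hV1, mul_one]

theorem integrable_indicator_of_isOpen {m : ℕ} {F : Type*} [NormedAddCommGroup F]
    {U : Set (Euc m)} (hU : IsOpen U) {g : Euc m → F} (hg : IntegrableOn g U) :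
    Integrable (U.indicator g) :=
  hg.integrable_indicator hU.measurableSet

theorem integrable_normed_smul {m : ℕ} {F : Type*} [NormedAddCommGroup F] [NormedSpace ℝ F]
    {g : Euc m → F} (hg : Integrable g) (φ : ContDiffBump (0 : Euc m)) (z : Euc m) :
    Integrable fun w => φ.normed volume (z - w) • g w := by
  have hφ : Continuous (φ.normed volume) := (φ.contDiff_normed (n := 0)).continuous
  obtain ⟨K, hK⟩ := hφ.bounded_above_of_compact_support φ.hasCompactSupport_normed
  exact hg.bdd_smul K (hφ.comp (continuous_const.sub continuous_id)).aestronglyMeasurable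
    (Eventually.of_forall fun w => hK _)

/-- The derivative falls on the bump, and `w ↦ φ.normed volume (z - w)` is an admissible test
function because its support lies in `closedBall z φ.rOut`. -/
theorem fderiv_mollify {m n : ℕ} {U : Set (Euc m)} (hU : IsOpen U) {f : Euc m → Euc n}
    {G : Euc m → Euc m →L[ℝ] Euc n} (hf : IntegrableOn f U) (hG : IntegrableOn G U)
    (hfG : HasWeakDeriv U f G) (φ : ContDiffBump (0 : Euc m)) {z : Euc m}
    (hz : Metric.closedBall z φ.rOut ⊆ U) :
    fderiv ℝ (φ.normed volume ⋆[ContinuousLinearMap.lsmul ℝ ℝ, volume] U.indicator f) z =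
      ∫ w, φ.normed volume (z - w) • U.indicator G w := by
  have hfi : Integrable (U.indicator f) := integrable_indicator_of_isOpen hU hf
  have hsmooth : ContDiff ℝ (⊤ : ℕ∞) (φ.normed volume) := φ.contDiff_normed
  have hsmooth1 : ContDiff ℝ 1 (φ.normed volume) := φ.contDiff_normed (n := 1)
  have hGU : Integrable (U.indicator G) := integrable_indicator_of_isOpen hU hG
  have hGi := integrable_normed_smul hGU φ z
  have hd := φ.hasCompactSupport_normed.hasFDerivAt_convolution_left
    (ContinuousLinearMap.lsmul ℝ ℝ) hsmooth1 hfi.locallyIntegrable z (μ := volume)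
  rw [hd.fderiv]
  have hex := (φ.hasCompactSupport_normed.fderiv ℝ).convolutionExists_left
    ((ContinuousLinearMap.lsmul ℝ ℝ).precompL (Euc m))
    (hsmooth1.continuous_fderiv one_ne_zero) hfi.locallyIntegrable z (μ := volume)
  ext1 v
  rw [convolution_eq_swap, ContinuousLinearMap.integral_apply hex.integrable_swap,
    ContinuousLinearMap.integral_apply hGi]
  have htest := hfG (fun w => φ.normed volume (z - w)) 
    (hsmooth.comp (contDiff_const.sub contDiff_id)) ?_ ?_ v
  · have hfd : ∀ w, fderiv ℝ (fun w => φ.normed volume (z - w)) w v =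
        -(fderiv ℝ (φ.normed volume) (z - w) v) := by
      intro w
      have h1 : HasFDerivAt (φ.normed volume) (fderiv ℝ (φ.normed volume) (z - w)) (z - w) :=
        (hsmooth1.differentiable one_ne_zero _).hasFDerivAt
      have h2 : HasFDerivAt (fun w => φ.normed volume (z - w)) _ w :=
        h1.comp w ((hasFDerivAt_id w).const_sub z)
      rw [h2.fderiv]
      simp
    simp only [hfd, neg_smul, integral_neg, neg_inj] at htest
    rw [← integral_indicator hU.measurableSet, ← integral_indicator hU.measurableSet] at htest
    refine Eq.trans (integral_congr_ae (Eventually.of_forall fun w => ?_))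
      (htest.trans (integral_congr_ae (Eventually.of_forall fun w => ?_)))
    · by_cases hw : w ∈ U <;> simp [hw, ContinuousLinearMap.precompL_apply]
    · by_cases hw : w ∈ U <;> simp [hw]
  · exact φ.hasCompactSupport_normed.comp_homeomorph (Homeomorph.subLeft z)
  · refine Set.Subset.trans ?_ hz
    refine closure_minimal ?_ Metric.isClosed_closedBall
    intro w hw
    have : z - w ∈ Function.support (φ.normed volume) := hw
    rw [φ.support_normed_eq, mem_ball_zero_iff, ← dist_eq_norm, dist_comm] at this
    exact Metric.mem_closedBall.2 this.le

/-- The bump has integral one, so the constant `L` is its own mollification and can be subtracted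
under the integral. -/
theorem enorm_fderiv_mollify_sub_le {m n : ℕ} {U : Set (Euc m)} (hU : IsOpen U)
    {f : Euc m → Euc n} {G : Euc m → Euc m →L[ℝ] Euc n} (hf : IntegrableOn f U)
    (hG : IntegrableOn G U) (hfG : HasWeakDeriv U f G) (φ : ContDiffBump (0 : Euc m)) {z : Euc m}
    (hz : Metric.closedBall z φ.rOut ⊆ U) (L : Euc m →L[ℝ] Euc n) :
    ‖fderiv ℝ (φ.normed volume ⋆[ContinuousLinearMap.lsmul ℝ ℝ, volume] U.indicator f) z - L‖ₑ ≤
      ∫⁻ w, ENNReal.ofReal (φ.normed volume (z - w)) * ‖U.indicator G w - L‖ₑ := by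
  have hGU : Integrable (U.indicator G) := integrable_indicator_of_isOpen hU hG
  have hGi := integrable_normed_smul hGU φ z
  have hLi : Integrable fun w => φ.normed volume (z - w) • L :=
    (φ.integrable_normed.comp_sub_left z).smul_const L
  have hL : ∫ w, φ.normed volume (z - w) • L = L := by
    rw [integral_smul_const, integral_sub_left_eq_self (φ.normed volume) volume z,
      φ.integral_normed, one_smul]
  rw [fderiv_mollify hU hf hG hfG φ hz]
  nth_rw 1 [← hL]
  rw [← integral_sub hGi hLi]
  refine (enorm_integral_le_lintegral_enorm _).trans (lintegral_mono fun w => ?_)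
  dsimp only
  rw [← smul_sub (φ.normed volume (z - w)) (U.indicator G w) L, enorm_smul, 
    Real.enorm_of_nonneg (φ.nonneg_normed _)]

/-! ### Approximate differentiability of Sobolev functions -/

/-- The fundamental theorem of calculus along the segment from `x` to `y`, applied to `u` minus its
linear model. -/
theorem ofReal_norm_remainder_div_le {m n : ℕ} {u : Euc m → Euc n} (hu : ContDiff ℝ 1 u)
    (L : Euc m →L[ℝ] Euc n) (x y : Euc m) :
    ENNReal.ofReal (‖u y - u x - L (y - x)‖ / ‖y - x‖) ≤
      ∫⁻ t in Set.Ioc (0 : ℝ) 1, ‖fderiv ℝ u (x + t • (y - x)) - L‖ₑ := by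
  rcases eq_or_ne y x with rfl | hyx
  · simp
  have hpos : 0 < ‖y - x‖ := norm_pos_iff.2 (sub_ne_zero.2 hyx)
  set D : ℝ → Euc m →L[ℝ] Euc n := fun t => fderiv ℝ u (x + t • (y - x)) - L with hD
  have hDc : Continuous D :=
    ((hu.continuous_fderiv one_ne_zero).comp (by fun_prop)).sub continuous_const
  have hder : ∀ t ∈ Set.uIcc (0 : ℝ) 1,
      HasDerivAt (fun t => u (x + t • (y - x)) - t • L (y - x)) (D t (y - x)) t := by
    intro t _
    have h1 : HasDerivAt (fun t : ℝ => x + t • (y - x)) (y - x) t := by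
      simpa using ((hasDerivAt_id t).smul_const (y - x)).const_add x
    have h2 := ((hu.differentiable one_ne_zero) (x + t • (y - x))).hasFDerivAt.comp_hasDerivAt t h1
    have h3 : HasDerivAt (fun t : ℝ => t • L (y - x)) (L (y - x)) t := by
      simpa using (hasDerivAt_id t).smul_const (L (y - x))
    exact h2.sub h3
  have hftc := intervalIntegral.integral_eq_sub_of_hasDerivAt hder
    ((hDc.clm_apply continuous_const).intervalIntegrable 0 1)
  have heq : u y - u x - L (y - x) = ∫ t in Set.Ioc (0 : ℝ) 1, D t (y - x) := by
    rw [← intervalIntegral.integral_of_le zero_le_one, hftc]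
    simp only [one_smul, zero_smul, add_sub_cancel, add_zero, sub_zero]
    abel
  rw [ENNReal.ofReal_div_of_pos hpos, ofReal_norm, ofReal_norm, heq]
  refine ENNReal.div_le_of_le_mul ?_
  rw [← lintegral_mul_const' _ _ enorm_ne_top]
  refine (enorm_integral_le_lintegral_enorm _).trans (lintegral_mono fun t => ?_)
  exact ContinuousLinearMap.le_opENorm _ _

theorem setLIntegral_comp_homothety_le {m : ℕ} (k : Euc m → ℝ≥0∞) (x : Euc m) (r : ℝ) {t : ℝ}
    (ht : 0 < t) :
    ENNReal.ofReal (t ^ m) * ∫⁻ y in Metric.closedBall x r, k (x + t • (y - x)) ≤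
      ∫⁻ z in Metric.closedBall x (t * r), k z := by
  have hder : ∀ y ∈ Metric.closedBall x r, HasFDerivWithinAt (fun y => x + t • (y - x))
      (t • ContinuousLinearMap.id ℝ (Euc m)) (Metric.closedBall x r) y := fun y _ =>
    (((hasFDerivAt_id y).sub_const x).const_smul t).const_add x |>.hasFDerivWithinAt
  have hinj : Set.InjOn (fun y => x + t • (y - x)) (Metric.closedBall x r) := by
    intro y _ z _ hyz
    simpa [ht.ne'] using hyz
  have h := lintegral_image_eq_lintegral_abs_det_fderiv_mul volume
    Metric.isClosed_closedBall.measurableSet hder hinj k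
  have hdet : (t • ContinuousLinearMap.id ℝ (Euc m)).det = t ^ m := by
    simp [ContinuousLinearMap.det]
  simp only [hdet, abs_of_pos (pow_pos ht m)] at h
  rw [lintegral_const_mul' _ _ ENNReal.ofReal_ne_top] at h
  rw [← h]
  refine lintegral_mono_set ?_
  rintro _ ⟨y, hy, rfl⟩
  rw [mem_closedBall_iff_norm] at hy ⊢
  simp only [add_sub_cancel_left, norm_smul, Real.norm_of_nonneg ht.le]
  gcongr

/-- After exchanging the integrals, the homothety of ratio `t` turns the inner one into an integral
over the ball of radius `t * r`; its Jacobian `t ^ m` cancels against the volume of that ball. -/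
theorem setLIntegral_remainder_div_le {m n : ℕ} {u : Euc m → Euc n} (hu : ContDiff ℝ 1 u)
    (L : Euc m →L[ℝ] Euc n) {x : Euc m} {r : ℝ} (hr : 0 < r) {K : ℝ≥0∞}
    (hK : ∀ s, 0 < s → s ≤ r → ∫⁻ z in Metric.closedBall x s, ‖fderiv ℝ u z - L‖ₑ ≤
      K * volume (Metric.closedBall x s)) :
    ∫⁻ y in Metric.closedBall x r, ENNReal.ofReal (‖u y - u x - L (y - x)‖ / ‖y - x‖) ≤
      K * volume (Metric.closedBall x r) := by
  have hc := hu.continuous_fderiv one_ne_zero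
  calc _ ≤ ∫⁻ y in Metric.closedBall x r,
          ∫⁻ t in Set.Ioc (0 : ℝ) 1, ‖fderiv ℝ u (x + t • (y - x)) - L‖ₑ :=
        lintegral_mono fun y => ofReal_norm_remainder_div_le hu L x y
    _ = ∫⁻ t in Set.Ioc (0 : ℝ) 1,
          ∫⁻ y in Metric.closedBall x r, ‖fderiv ℝ u (x + t • (y - x)) - L‖ₑ := by
        refine lintegral_lintegral_swap ?_
        refine Continuous.aemeasurable (Continuous.enorm (Continuous.sub ?_ continuous_const))
        have hg : Continuous fun p : Euc m × ℝ => x + p.2 • (p.1 - x) := by fun_prop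
        exact hc.comp hg
    _ ≤ ∫⁻ _ in Set.Ioc (0 : ℝ) 1, K * volume (Metric.closedBall x r) := by
        refine setLIntegral_mono' measurableSet_Ioc fun t ht => ?_
        have h1 := setLIntegral_comp_homothety_le (fun z => ‖fderiv ℝ u z - L‖ₑ) x r ht.1
        have h2 := hK (t * r) (mul_pos ht.1 hr) (mul_le_of_le_one_left hr.le ht.2)
        rw [volume_closedBall_mul x x ht.1.le hr.le, mul_left_comm] at h2
        refine (ENNReal.mul_le_mul_iff_right ?_ ENNReal.ofReal_ne_top).1 (h1.trans h2)
        exact (ENNReal.ofReal_pos.2 (pow_pos ht.1 m)).ne'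
    _ = _ := by simp

/-- A sequence of bump functions at the origin with radii tending to zero. -/
def shrinkingBump (m k : ℕ) : ContDiffBump (0 : Euc m) where
  rIn := 1 / (k + 1)
  rOut := 2 * (1 / (k + 1))
  rIn_pos := by positivity
  rIn_lt_rOut := by
    have : (0 : ℝ) < 1 / (k + 1) := by positivity
    linarith

theorem tendsto_rOut_shrinkingBump (m : ℕ) :
    Tendsto (fun k => (shrinkingBump m k).rOut) atTop (𝓝 0) := by
  simpa [shrinkingBump] using
    (tendsto_one_div_add_atTop_nhds_zero_nat (𝕜 := ℝ)).const_mul 2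

/-- The bound holds for the mollifications of `f` once their radius is below `R - r`, and Fatou's
lemma carries it to the limit. Convergence at the centre `x` itself is needed because `u k x` enters
the remainder. -/
theorem setLIntegral_weak_remainder_div_le {m n : ℕ} {U : Set (Euc m)} (hU : IsOpen U)
    {f : Euc m → Euc n} {G : Euc m → Euc m →L[ℝ] Euc n} (hf : IntegrableOn f U)
    (hG : IntegrableOn G U) (hfG : HasWeakDeriv U f G)
    (hconv : ∀ᵐ y, Tendsto (fun k => ((shrinkingBump m k).normed volume
      ⋆[ContinuousLinearMap.lsmul ℝ ℝ, volume] U.indicator f) y) atTop (𝓝 (U.indicator f y)))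
    {x : Euc m} (hx : Tendsto (fun k => ((shrinkingBump m k).normed volume
      ⋆[ContinuousLinearMap.lsmul ℝ ℝ, volume] U.indicator f) x) atTop (𝓝 (U.indicator f x)))
    {L : Euc m →L[ℝ] Euc n} {η : ℝ≥0∞} {R : ℝ} (hR : Metric.closedBall x R ⊆ U)
    (hη : ∀ s, 0 < s → s ≤ R → ∫⁻ w in Metric.closedBall x s, ‖U.indicator G w - L‖ₑ ≤
      η * volume (Metric.closedBall x s)) {r : ℝ} (hr : 0 < r) (hrR : r < R) :
    ∫⁻ y in Metric.closedBall x r, ENNReal.ofReal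
        (‖U.indicator f y - U.indicator f x - L (y - x)‖ / ‖y - x‖) ≤
      4 ^ m * η * volume (Metric.closedBall x r) := by
  set u : ℕ → Euc m → Euc n := fun k => (shrinkingBump m k).normed volume
    ⋆[ContinuousLinearMap.lsmul ℝ ℝ, volume] U.indicator f with hu
  have hfi : Integrable (U.indicator f) := integrable_indicator_of_isOpen hU hf
  have hGi : Integrable (U.indicator G) := integrable_indicator_of_isOpen hU hG
  have hsmooth : ∀ k, ContDiff ℝ 1 (u k) := fun k =>
    (shrinkingBump m k).hasCompactSupport_normed.contDiff_convolution_left _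
      ((shrinkingBump m k).contDiff_normed (n := 1)) hfi.locallyIntegrable
  have hbound : ∀ᶠ k in atTop, ∫⁻ y in Metric.closedBall x r,
      ENNReal.ofReal (‖u k y - u k x - L (y - x)‖ / ‖y - x‖) ≤
        4 ^ m * η * volume (Metric.closedBall x r) := by
    filter_upwards [(tendsto_rOut_shrinkingBump m).eventually_lt_const (sub_pos.2 hrR)] with k hk
    refine setLIntegral_remainder_div_le (hsmooth k) L hr fun s hs hsr => ?_
    refine le_trans ?_ (setLIntegral_mollify_le (φ := shrinkingBump m k) le_rfl
      (h := fun w => ‖U.indicator G w - L‖ₑ)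
      (hGi.aestronglyMeasurable.sub aestronglyMeasurable_const).enorm hη hs (by linarith))
    refine setLIntegral_mono' Metric.isClosed_closedBall.measurableSet fun z hz => ?_
    refine enorm_fderiv_mollify_sub_le hU hf hG hfG _ (Set.Subset.trans ?_ hR) L
    refine Metric.closedBall_subset_closedBall' ?_
    rw [Metric.mem_closedBall] at hz
    linarith
  calc _ = ∫⁻ y in Metric.closedBall x r, liminf (fun k => ENNReal.ofReal
          (‖u k y - u k x - L (y - x)‖ / ‖y - x‖)) atTop := by
        refine lintegral_congr_ae (ae_restrict_of_ae ?_)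
        filter_upwards [hconv] with y hy
        refine (Tendsto.liminf_eq ?_).symm
        exact ENNReal.tendsto_ofReal ((((hy.sub hx).sub_const _).norm).div_const _)
    _ ≤ liminf (fun k => ∫⁻ y in Metric.closedBall x r, ENNReal.ofReal
          (‖u k y - u k x - L (y - x)‖ / ‖y - x‖)) atTop := by
        refine lintegral_liminf_le fun k => ENNReal.measurable_ofReal.comp ?_
        have := (hsmooth k).continuous
        exact (by fun_prop : Continuous fun y => ‖u k y - u k x - L (y - x)‖).measurable.div
          (by fun_prop : Continuous fun y => ‖y - x‖).measurable
    _ ≤ _ := liminf_le_of_frequently_le' hbound.frequently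

/-- Chebyshev's inequality: a small mean of the difference quotient leaves little room for values
above `ε`. -/
theorem hasApFDerivAt_of_tendsto {m n : ℕ} {U : Set (Euc m)} (hU : IsOpen U) {f : Euc m → Euc n}
    (hf : AEStronglyMeasurable f (volume.restrict U)) {L : Euc m →L[ℝ] Euc n} {x : Euc m}
    (hx : x ∈ U)
    (h : Tendsto (fun r : ℝ => (∫⁻ y in Metric.closedBall x r,
      ENNReal.ofReal (‖f y - f x - L (y - x)‖ / ‖y - x‖)) / volume (Metric.closedBall x r))
      (𝓝[>] 0) (𝓝 0)) :
    HasApFDerivAt f L x := by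
  intro ε hε
  have hε' : ENNReal.ofReal ε ≠ 0 := (ENNReal.ofReal_pos.2 hε).ne'
  have h2 := ENNReal.Tendsto.div_const h (Or.inr hε') (b := ENNReal.ofReal ε)
  rw [ENNReal.zero_div] at h2
  obtain ⟨R, hR, hRU⟩ := Metric.nhds_basis_closedBall.mem_iff.1 (hU.mem_nhds hx)
  refine tendsto_of_tendsto_of_tendsto_of_le_of_le' tendsto_const_nhds h2
    (Eventually.of_forall fun _ => zero_le) ?_
  filter_upwards [Ioo_mem_nhdsGT hR] with r hr
  rw [ENNReal.div_right_comm]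
  gcongr
  have hsub := (Metric.closedBall_subset_closedBall hr.2.le).trans hRU
  have hfm : AEMeasurable f (volume.restrict (Metric.closedBall x r)) :=
    (hf.mono_measure (Measure.restrict_mono_set _ hsub)).aemeasurable
  have hm : AEMeasurable (fun y => ENNReal.ofReal (‖f y - f x - L (y - x)‖ / ‖y - x‖))
      (volume.restrict (Metric.closedBall x r)) := by
    refine (AEMeasurable.div (((hfm.sub_const _).sub ?_).norm) ?_).ennreal_ofReal
    · exact (by fun_prop : Continuous fun y => L (y - x)).aemeasurable
    · exact (by fun_prop : Continuous fun y => ‖y - x‖).aemeasurable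
  refine le_trans (le_of_eq ?_) (meas_ge_le_lintegral_div hm hε' ENNReal.ofReal_ne_top)
  rw [Measure.restrict_apply' Metric.isClosed_closedBall.measurableSet, Set.inter_comm]
  congr 2
  ext y
  simp only [Set.mem_ofPred_eq, sub_zero]
  rw [abs_of_nonneg (by positivity), ENNReal.ofReal_le_ofReal_iff (by positivity)]

/-- A function with an integrable weak derivative `G` on an open set is approximately
differentiable almost everywhere there, with approximate differential `G`. -/
theorem HasWeakDeriv.ae_hasApFDerivAt {m n : ℕ} {U : Set (Euc m)} (hU : IsOpen U)
    {f : Euc m → Euc n} {G : Euc m → Euc m →L[ℝ] Euc n} (hfG : HasWeakDeriv U f G)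
    (hf : IntegrableOn f U) (hG : IntegrableOn G U) :
    ∀ᵐ x ∂(volume.restrict U), HasApFDerivAt f (G x) x := by
  have hfi : Integrable (U.indicator f) := integrable_indicator_of_isOpen hU hf
  have hGi : Integrable (U.indicator G) := integrable_indicator_of_isOpen hU hG
  have hconv := ContDiffBump.ae_convolution_tendsto_right_of_locallyIntegrable (μ := volume)
    (φ := shrinkingBump m) (K := 2) (tendsto_rOut_shrinkingBump m)
    (Eventually.of_forall fun _ => le_rfl) hfi.locallyIntegrable
  have hleb := (Besicovitch.vitaliFamily (volume : Measure (Euc m))).ae_tendsto_lintegral_enorm_sub_div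
    hGi.locallyIntegrable
  rw [ae_restrict_iff' hU.measurableSet]
  filter_upwards [hconv, hleb] with x hx hGx hxU
  have hlim := hGx.comp (Besicovitch.tendsto_filterAt volume x)
  refine hasApFDerivAt_of_tendsto hU hf.aestronglyMeasurable hxU ?_
  rw [ENNReal.tendsto_nhds_zero]
  intro ε hε
  -- Compensates for the factor `4 ^ m` lost by mollifying.
  have hη : 0 < ε / 4 ^ m := ENNReal.div_pos hε.ne' (by simp)
  obtain ⟨R₁, hR₁, hR₁U⟩ := Metric.nhds_basis_closedBall.mem_iff.1 (hU.mem_nhds hxU)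
  obtain ⟨R₂, hR₂, hR₂η⟩ := mem_nhdsGT_iff_exists_Ioc_subset.1
    (ENNReal.tendsto_nhds_zero.1 hlim _ hη)
  have hR : 0 < min R₁ R₂ := lt_min hR₁ hR₂
  filter_upwards [Ioo_mem_nhdsGT hR] with r hr
  have hV : ∀ s, 0 < s → volume (Metric.closedBall x s) ≠ 0 := fun s hs =>
    (Metric.measure_closedBall_pos _ _ hs).ne'
  have hsub : Metric.closedBall x (min R₁ R₂) ⊆ U :=
    (Metric.closedBall_subset_closedBall (min_le_left _ _)).trans hR₁U
  have key := setLIntegral_weak_remainder_div_le hU hf hG hfG hconv hx (L := G x)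
    (η := ε / 4 ^ m) hsub (fun s hs hsR => by
      have := hR₂η ⟨hs, hsR.trans (min_le_right _ _)⟩
      simp only [Set.mem_ofPred_eq, Function.comp_apply, Set.indicator_of_mem hxU] at this
      rwa [ENNReal.div_le_iff (hV s hs) measure_closedBall_lt_top.ne] at this) hr.1 hr.2
  rw [ENNReal.mul_div_cancel (by simp) (by simp)] at key
  rw [ENNReal.div_le_iff (hV r hr.1) measure_closedBall_lt_top.ne]
  refine le_trans (le_of_eq ?_) key
  refine setLIntegral_congr_fun Metric.isClosed_closedBall.measurableSet fun y hy => ?_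
  have hyU : y ∈ U := hsub (Metric.closedBall_subset_closedBall hr.2.le hy)
  simp only [Set.indicator_of_mem hxU, Set.indicator_of_mem hyU]

/-! ### The Dirichlet integral of a sum of Sobolev sheets -/

theorem memLp_add {m : ℕ} {E : Type*} [NormedAddCommGroup E] {μ : Measure (Euc m)} {p : ℝ≥0∞}
    {f g : Euc m → E} (hf : MemLp f p μ) (hg : MemLp g p μ) : MemLp (f + g) p μ :=
  hf.add hg

theorem integrable_matInner {m n : ℕ} {μ : Measure (Euc m)} {G H : Euc m → Euc m →L[ℝ] Euc n}
    (hG : MemLp G 2 μ) (hH : MemLp H 2 μ) : Integrable (fun x => matInner (G x) (H x)) μ := by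
  refine integrable_finsetSum _ fun k _ => ?_
  have happ : ∀ {F : Euc m → Euc m →L[ℝ] Euc n}, MemLp F 2 μ →
      MemLp (fun x => F x (EuclideanSpace.single k 1)) 2 μ := fun hF =>
    (ContinuousLinearMap.apply ℝ (Euc n) (EuclideanSpace.single k (1 : ℝ))).comp_memLp' hF
  refine ((happ hG).norm.integrable_mul (happ hH).norm).mono'
    ((happ hG).aestronglyMeasurable.inner (happ hH).aestronglyMeasurable)
    (Eventually.of_forall fun x => norm_inner_le_norm _ _)

theorem matInner_sum_sum {m n p q : ℕ} (L : Fin p → Euc m →L[ℝ] Euc n)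
    (M : Fin q → Euc m →L[ℝ] Euc n) :
    matInner (∑ i, L i) (∑ j, M j) = ∑ i, ∑ j, matInner (L i) (M j) := by
  simp only [matInner, sum_apply, sum_inner, inner_sum]
  rw [Finset.sum_comm]
  simp only [Finset.sum_comm (s := Finset.univ (α := Fin m)) (t := Finset.univ (α := Fin p))]
  exact Finset.sum_comm

theorem matInner_smul_smul {m n : ℕ} (a b : ℝ) (L M : Euc m →L[ℝ] Euc n) :
    matInner (a • L) (b • M) = a * b * matInner L M := by
  simp only [matInner, smul_apply, real_inner_smul_left, real_inner_smul_right,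
    Finset.mul_sum]
  exact Finset.sum_congr rfl fun k _ => by ring

theorem matInner_add_self {m n : ℕ} (L M : Euc m →L[ℝ] Euc n) :
    matInner (L + M) (L + M) = matInner L L + matInner M M + 2 * matInner L M := by
  simp only [matInner, add_apply, real_inner_add_add_self, Finset.sum_add_distrib, Finset.mul_sum]
  ring

/-- Each `L i` occurs with `q` partners and each `M j` with `p`; the cross terms add up to the inner
product of the sums, and the factor `p * q` undoes the two averages. -/
theorem sum_matInner_add_self {m n p q : ℕ} (hp : 0 < p) (hq : 0 < q)
    (L : Fin p → Euc m →L[ℝ] Euc n) (M : Fin q → Euc m →L[ℝ] Euc n) :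
    ∑ k : Fin (p * q), matInner
        (L (finProdFinEquiv.symm k).1 + M (finProdFinEquiv.symm k).2)
        (L (finProdFinEquiv.symm k).1 + M (finProdFinEquiv.symm k).2) =
      q * ∑ i, matInner (L i) (L i) + p * ∑ j, matInner (M j) (M j) +
        2 * p * q * matInner ((p : ℝ)⁻¹ • ∑ i, L i) ((q : ℝ)⁻¹ • ∑ j, M j) := by
  have hp' : (p : ℝ) ≠ 0 := by positivity
  have hq' : (q : ℝ) ≠ 0 := by positivity
  rw [Equiv.sum_comp finProdFinEquiv.symm
    (fun c : Fin p × Fin q => matInner (L c.1 + M c.2) (L c.1 + M c.2)), Fintype.sum_prod_type,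
    matInner_smul_smul, matInner_sum_sum]
  simp only [matInner_add_self, Finset.sum_add_distrib, ← Finset.mul_sum, Finset.sum_const,
    Finset.card_univ, Fintype.card_fin, nsmul_eq_mul]
  field_simp

theorem ae_normSq_apDeriv_eq {m n Q : ℕ} {μ : Measure (Euc m)} {u : Fin Q → Euc m → Euc n}
    {G : Fin Q → Euc m → Euc m →L[ℝ] Euc n}
    (h : ∀ᵐ x ∂μ, ∀ i, HasApFDerivAt (u i) (G i x) x) :
    (fun x => normSq (apDeriv (fun y => diracSum fun i => u i y) x)) =ᵐ[μ]
      fun x => ∑ i, matInner (G i x) (G i x) := by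
  filter_upwards [h] with x hx
  rw [(hasApDerivAt_diracSum hx).normSq_apDeriv, normSq_diracSum]

theorem finiteDir_diracSum {m n Q : ℕ} {U : Set (Euc m)} {u : Fin Q → Euc m → Euc n}
    {G : Fin Q → Euc m → Euc m →L[ℝ] Euc n}
    (h : ∀ᵐ x ∂(volume.restrict U), ∀ i, HasApFDerivAt (u i) (G i x) x)
    (hG : ∀ i, MemLp (G i) 2 (volume.restrict U)) :
    FiniteDir U fun y => diracSum fun i => u i y := by
  refine ⟨?_, ?_⟩
  · filter_upwards [h] with x hx using ⟨_, hasApDerivAt_diracSum hx⟩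
  · exact (integrable_finsetSum _ fun i _ => integrable_matInner (hG i) (hG i)).congr
      (ae_normSq_apDeriv_eq h).symm

theorem hasApFDerivAt_average_diracSum {m n Q : ℕ} {u : Fin Q → Euc m → Euc n}
    {L : Fin Q → Euc m →L[ℝ] Euc n} {x : Euc m} (h : ∀ i, HasApFDerivAt (u i) (L i) x) :
    HasApFDerivAt (fun y => average (diracSum fun i => u i y)) ((Q : ℝ)⁻¹ • ∑ i, L i) x := by
  simp only [average_diracSum]
  exact (HasApFDerivAt.sum fun i _ => h i).const_smul _

/-- A `W^{1,2}` function on an open set of finite measure has almost everywhere an approximate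
differential, which is square integrable. -/
theorem MemW12.exists_ae_hasApFDerivAt {m n : ℕ} {U : Set (Euc m)} (hU : IsOpen U)
    (hfin : volume U ≠ ∞) {u : Euc m → Euc n} (hu : MemW12 U u) :
    ∃ G : Euc m → Euc m →L[ℝ] Euc n, MemLp G 2 (volume.restrict U) ∧
      ∀ᵐ x ∂(volume.restrict U), HasApFDerivAt u (G x) x := by
  have : IsFiniteMeasure (volume.restrict U) := isFiniteMeasure_restrict.2 hfin
  obtain ⟨hu, G, hG, huG⟩ := hu
  exact ⟨G, hG, huG.ae_hasApFDerivAt hU (hu.integrable one_le_two) (hG.integrable one_le_two)⟩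

end MultiValued

end

open MeasureTheory MultiValued in
theorem theorem4p2 (m n p q : ℕ) (hm : 0 < m) (hn : 0 < n) (hp : 0 < p) (hq : 0 < q)
    (B : Set (Euc m)) (hB : B = Metric.ball 0 1)
    (fi : Fin p → Euc m → Euc n) (gj : Fin q → Euc m → Euc n)
    (hf : ∀ i, MemW12 B (fi i)) (hfs : ∀ i, StrictlyDefined B (fi i))
    (hg : ∀ j, MemW12 B (gj j)) (hgs : ∀ j, StrictlyDefined B (gj j))
    (f : Euc m → Sym (Euc n) p) (hfdef : ∀ x, f x = diracSum fun i => fi i x)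
    (g : Euc m → Sym (Euc n) q) (hgdef : ∀ x, g x = diracSum fun j => gj j x) :
    -- all the quantities below are well defined and finite
    FiniteDir B f ∧ FiniteDir B g ∧ FiniteDir B (tensorSum f g) ∧
    (∀ᵐ x ∂(volume.restrict B), ∃ L, HasApFDerivAt (fun y => average (f y)) L x) ∧
    (∀ᵐ x ∂(volume.restrict B), ∃ L, HasApFDerivAt (fun y => average (g y)) L x) ∧
    IntegrableOn (fun x => matInner (apFDeriv (fun y => average (f y)) x)
      (apFDeriv (fun y => average (g y)) x)) B ∧
    -- the identity
    Dir B (tensorSum f g) = q * Dir B f + p * Dir B g +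
      2 * p * q * ∫ x in B, matInner (apFDeriv (fun y => average (f y)) x)
        (apFDeriv (fun y => average (g y)) x) := by
  have hBo : IsOpen B := hB ▸ Metric.isOpen_ball
  have hBfin : volume B ≠ ⊤ := hB ▸ measure_ball_lt_top.ne
  obtain rfl : f = fun y => diracSum fun i => fi i y := funext hfdef
  obtain rfl : g = fun y => diracSum fun j => gj j y := funext hgdef
  choose F hF hfF using fun i => (hf i).exists_ae_hasApFDerivAt hBo hBfin
  choose G hG hgG using fun j => (hg j).exists_ae_hasApFDerivAt hBo hBfin
  have hfF := ae_all_iff.2 hfF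
  have hgG := ae_all_iff.2 hgG
  -- The tensor sum is again a sum of sheets, indexed by pairs, so the same lemmas apply to it.
  have htensor : tensorSum (fun y => diracSum fun i => fi i y)
      (fun y => diracSum fun j => gj j y) = fun y => diracSum fun k : Fin (p * q) =>
        fi (finProdFinEquiv.symm k).1 y + gj (finProdFinEquiv.symm k).2 y :=
    funext fun y => symAdd_diracSum _ _
  have hfgFG : ∀ᵐ x ∂(volume.restrict B), ∀ k : Fin (p * q), HasApFDerivAt
      (fun y => fi (finProdFinEquiv.symm k).1 y + gj (finProdFinEquiv.symm k).2 y)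
      ((F (finProdFinEquiv.symm k).1 + G (finProdFinEquiv.symm k).2) x) x := by
    filter_upwards [hfF, hgG] with x hx hy k using (hx _).add (hy _)
  have hmean : (fun x => matInner (apFDeriv (fun y => average (diracSum fun i => fi i y)) x)
      (apFDeriv (fun y => average (diracSum fun j => gj j y)) x)) =ᵐ[volume.restrict B]
      fun x => matInner ((p : ℝ)⁻¹ • ∑ i, F i x) ((q : ℝ)⁻¹ • ∑ j, G j x) := by
    filter_upwards [hfF, hgG] with x hx hy
    rw [(hasApFDerivAt_average_diracSum hx).apFDeriv_eq,
      (hasApFDerivAt_average_diracSum hy).apFDeriv_eq]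
  have hint : Integrable (fun x => matInner ((p : ℝ)⁻¹ • ∑ i, F i x) ((q : ℝ)⁻¹ • ∑ j, G j x))
      (volume.restrict B) := by
    simp only [matInner_smul_smul, matInner_sum_sum]
    exact (integrable_finsetSum _ fun i _ => integrable_finsetSum _ fun j _ =>
      integrable_matInner (hF i) (hG j)).const_mul _
  have hintF : Integrable (fun x => ∑ i, matInner (F i x) (F i x)) (volume.restrict B) :=
    integrable_finsetSum _ fun i _ => integrable_matInner (hF i) (hF i)
  have hintG : Integrable (fun x => ∑ j, matInner (G j x) (G j x)) (volume.restrict B) :=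
    integrable_finsetSum _ fun j _ => integrable_matInner (hG j) (hG j)
  refine ⟨finiteDir_diracSum hfF hF, finiteDir_diracSum hgG hG, ?_, ?_, ?_,
    hint.congr hmean.symm, ?_⟩
  · rw [htensor]
    exact finiteDir_diracSum hfgFG fun k => memLp_add (hF _) (hG _)
  · filter_upwards [hfF] with x hx using ⟨_, hasApFDerivAt_average_diracSum hx⟩
  · filter_upwards [hgG] with x hx using ⟨_, hasApFDerivAt_average_diracSum hx⟩
  · rw [htensor, Dir, Dir, Dir, integral_congr_ae (ae_normSq_apDeriv_eq hfF),
      integral_congr_ae (ae_normSq_apDeriv_eq hgG), integral_congr_ae (ae_normSq_apDeriv_eq hfgFG),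
      integral_congr_ae hmean]
    have hsum : ∀ x, _ = _ := fun x =>
      sum_matInner_add_self hp hq (fun i => F i x) (fun j => G j x)
    have hqF := hintF.const_mul (q : ℝ)
    have hpG := hintG.const_mul (p : ℝ)
    simp only [Pi.add_apply, hsum]
    refine (integral_add (hqF.add hpG) (hint.const_mul _)).trans ?_
    rw [integral_add' hqF hpG]
    simp only [integral_const_mul]
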